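/- Let $R$ be a commutative ring with unity. An $R$-module $M$ admits a degreewise finite projective resolution if there is an exact sequence $\cdots\to P_1\to P_0\to M\to 0$ with every $P_i$ a finitely generated projective $R$-module. Let $C$ be a semidualizing $R$-module, that is, $C$ admits a degreewise finite projective resolution, the homothety map $R\to\operatorname{Hom}_R(C,C)$ is an isomorphism, and $\operatorname{Ext}^{i}_R(C,C)=0$ for all $i\geqslant 1$. A complete $PC$-resolution is an exact sequence of $R$-modules $$X=\cdots\to P_1\to P_0\to C\otimes_R Q^0\to C\otimes_R Q^1\to\cdots$$ with every $P_i$ and $Q^i$ projective, such that the complex $\operatorname{Hom}_R(X,C\otimes_R Q)$ is exact for each projective $R$-module $Q$. An $R$-module $M$ is $G_C$-projective if there is a complete $PC$-resolution as above with $M\cong\operatorname{Coker}(P_1\to P_0)$. A class $\mathcal X$ of $R$-modules is projectively resolving if it contains every projective $R$-module and, for every exact sequence of $R$-modules $0\to M'\to M\to M''\to 0$ with $M''\in\mathcal X$, one has $M\in\mathcal X$ if and only if $M'\in\mathcal X$. It is finite projectively resolving if it consists of finitely generated $R$-modules, contains every finitely generated projective $R$-module, and, for every exact sequence of finitely generated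 $R$-modules $0\to M'\to M\to M''\to 0$ with $M''\in\mathcal X$, one has $M\in\mathcal X$ if and only if $M'\in\mathcal X$. **Theorem.** The class of $G_C$-projective $R$-modules is projectively resolving and closed under direct summands. The class of finitely generated $G_C$-projective $R$-modules is closed under direct summands. The class of $G_C$-projective $R$-modules admitting a degreewise finite projective resolution is finite projectively resolving. -/

import Mathlib

open scoped TensorProduct

universe u

namespace GCProj

/-- `M` admits a degreewise finite projective resolution: there is an exact sequence
`⋯ → P 1 → P 0 → M → 0` in which every `P n` is a finitely generated projective module. -/
def HasFiniteProjRes (R : Type u) [CommRing R] (M : Type u) [AddCommGroup M] [Module R M] :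
    Prop :=
  ∃ (P : ℕ → ModuleCat.{u} R) (d : ∀ n, P (n + 1) →ₗ[R] P n) (ε : P 0 →ₗ[R] M),
    (∀ n, Module.Projective R (P n)) ∧ (∀ n, Module.Finite R (P n)) ∧
      Function.Surjective ε ∧ Function.Exact (d 0) ε ∧
      ∀ n, Function.Exact (d (n + 1)) (d n)

/-- Semidualizing modules over a (not necessarily noetherian) commutative ring. The map
`LinearMap.lsmul R C` is the homothety map `R → Hom_R(C, C)`. -/
structure IsSemidualizing (R : Type u) [CommRing R] (C : Type u) [AddCommGroup C] [Module R C] :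
    Prop where
  finiteProjRes : HasFiniteProjRes R C
  homothety_bijective : Function.Bijective (LinearMap.lsmul R C)
  ext_eq_zero : ∀ n : ℕ, 1 ≤ n →
    Subsingleton (CategoryTheory.Abelian.Ext (ModuleCat.of R C) (ModuleCat.of R C) n)

/-- For `f : A → B` and `g : B → D`, exactness of the sequence
`Hom(D, N) → Hom(B, N) → Hom(A, N)` at its middle term. -/
def HomExact {R : Type u} [CommRing R] {A B D : Type u} [AddCommGroup A] [Module R A]
    [AddCommGroup B] [Module R B] [AddCommGroup D] [Module R D]
    (f : A →ₗ[R] B) (g : B →ₗ[R] D) (N : Type u) [AddCommGroup N] [Module R N] : Prop :=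
  Function.Exact (LinearMap.lcomp R N g) (LinearMap.lcomp R N f)

/-- A complete `PC`-resolution: an exact sequence
`⋯ → P 1 → P 0 → C ⊗ Q 0 → C ⊗ Q 1 → ⋯` with all `P n` and `Q n` projective, which remains
exact under `Hom(-, C ⊗ T)` for every projective module `T`. The differentials are
`dP n : P (n + 1) → P n`, `dPQ : P 0 → C ⊗ Q 0` and `dQ n : C ⊗ Q n → C ⊗ Q (n + 1)`. -/
structure CompletePCResolution (R : Type u) [CommRing R] (C : Type u) [AddCommGroup C]
    [Module R C] where
  P : ℕ → ModuleCat.{u} R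
  Q : ℕ → ModuleCat.{u} R
  projective_P : ∀ n, Module.Projective R (P n)
  projective_Q : ∀ n, Module.Projective R (Q n)
  dP : ∀ n, P (n + 1) →ₗ[R] P n
  dPQ : P 0 →ₗ[R] C ⊗[R] Q 0
  dQ : ∀ n, C ⊗[R] Q n →ₗ[R] C ⊗[R] Q (n + 1)
  exact_P_succ : ∀ n, Function.Exact (dP (n + 1)) (dP n)
  exact_P_zero : Function.Exact (dP 0) dPQ
  exact_Q_zero : Function.Exact dPQ (dQ 0)
  exact_Q_succ : ∀ n, Function.Exact (dQ n) (dQ (n + 1))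
  homExact_P_succ : ∀ T : ModuleCat.{u} R, Module.Projective R T →
    ∀ n, HomExact (dP (n + 1)) (dP n) (C ⊗[R] T)
  homExact_P_zero : ∀ T : ModuleCat.{u} R, Module.Projective R T →
    HomExact (dP 0) dPQ (C ⊗[R] T)
  homExact_Q_zero : ∀ T : ModuleCat.{u} R, Module.Projective R T →
    HomExact dPQ (dQ 0) (C ⊗[R] T)
  homExact_Q_succ : ∀ T : ModuleCat.{u} R, Module.Projective R T →
    ∀ n, HomExact (dQ n) (dQ (n + 1)) (C ⊗[R] T)

/-- `M` is `G_C`-projective: it is isomorphic to `Coker (P 1 → P 0)` for some complete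
`PC`-resolution. -/
def IsGCProjective (R : Type u) [CommRing R] (C : Type u) [AddCommGroup C] [Module R C]
    (M : Type u) [AddCommGroup M] [Module R M] : Prop :=
  ∃ X : CompletePCResolution R C, Nonempty (M ≃ₗ[R] (X.P 0 ⧸ LinearMap.range (X.dP 0)))

/-- Projectively resolving classes of modules. -/
structure IsProjectivelyResolving (R : Type u) [CommRing R] (𝒳 : ModuleCat.{u} R → Prop) :
    Prop where
  of_projective : ∀ P : ModuleCat.{u} R, Module.Projective R P → 𝒳 P
  mem_iff : ∀ (M' M M'' : ModuleCat.{u} R) (f : M' →ₗ[R] M) (g : M →ₗ[R] M''),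
    Function.Injective f → Function.Exact f g → Function.Surjective g →
      𝒳 M'' → (𝒳 M ↔ 𝒳 M')

/-- Finite projectively resolving classes of modules. -/
structure IsFiniteProjectivelyResolving (R : Type u) [CommRing R]
    (𝒳 : ModuleCat.{u} R → Prop) : Prop where
  finite : ∀ M : ModuleCat.{u} R, 𝒳 M → Module.Finite R M
  of_projective : ∀ P : ModuleCat.{u} R, Module.Finite R P → Module.Projective R P → 𝒳 P
  mem_iff : ∀ (M' M M'' : ModuleCat.{u} R) (f : M' →ₗ[R] M) (g : M →ₗ[R] M''),
    Module.Finite R M' → Module.Finite R M → Module.Finite R M'' →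
    Function.Injective f → Function.Exact f g → Function.Surjective g →
      𝒳 M'' → (𝒳 M ↔ 𝒳 M')

/-- Closure of a class of modules under direct summands. -/
def IsClosedUnderSummands (R : Type u) [CommRing R] (𝒳 : ModuleCat.{u} R → Prop) : Prop :=
  ∀ M A B : ModuleCat.{u} R, Nonempty (M ≃ₗ[R] (A × B)) → 𝒳 M → 𝒳 A

end GCProj

/-!
Fix a semidualizing module `C`. The proof rests on a one-step description of `G_C`-projectivity.
Write `M ∈ ⊥` if `Ext^n(M, C ⊗ T) = 0` for all `n ≥ 1` and all projective `T` (`IsLeftPerp`), and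
call a class of modules cosyzygy closed if each member `N` lies in `⊥` and fits into a short exact
sequence `0 → N → C ⊗ Q → N' → 0` with `Q` projective and `N'` in the class. Then the
`G_C`-projective modules form the largest cosyzygy closed class: splicing a free resolution with
successive embeddings gives a complete `PC`-resolution (`isGCProjective_of_closed`), and conversely
the cokernels in the right half of a complete `PC`-resolution form a cosyzygy closed class
(`IsSemidualizing.exists_cosyzygy`). The converse needs `C ⊗ Q ∈ ⊥` for `Q` projective, which
reduces to `Ext^n(C, C) = 0` because `C` has a degreewise finite projective resolution and
projective modules are retracts of free ones.

So a module is `G_C`-projective as soon as it lies in some cosyzygy closed class: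

* Extensions: the extensions of `G_C`-projective modules form such a class, by the dual horseshoe
  lemma.
* Kernels of surjections: for `0 → A → B → D → 0` and `0 → B → C ⊗ Q → N → 0`, the cokernel of
  `A → C ⊗ Q` is an extension of `N` by `D`.
* Direct summands: if `0 → A × B → C ⊗ Q → N → 0` is exact and `L` is the cokernel of
  `A → C ⊗ Q`, then `L × A` is an extension of `N` by `A × B`. So `L` is a summand of a
  `G_C`-projective module again, and the summands form a cosyzygy closed class.
* The ring: dualizing a resolution of `C` by finite free modules into `C` gives an exact sequence
  `0 → R → C ⊗ Rⁿ⁰ → C ⊗ Rⁿ¹ → ⋯`, whose cosyzygies are the duals `Hom(X, C)` of the syzygies `X`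
  of `C`. They lie in `⊥` because every `X` is reflexive with respect to `C`. Direct sums and
  summands then give all projective modules.

Degreewise finite projective resolutions are treated in the same style: they are characterized by
one-step covers (`HasFiniteProjRes.exists_cover`, `hasFiniteProjRes_of_closed`), the horseshoe lemma
handles extensions, and a pullback reduces kernels of surjections to extensions and to split
sequences.
-/

namespace GCProj

open CategoryTheory Abelian

/-! ### Short exact sequences and vanishing of `Ext` -/

section

variable {R : Type u} [CommRing R]

/-- The sequence `0 → A → B → D → 0` given by `f : A → B` and `g : B → D` is exact. -/
structure IsShortExact {A B D : Type*} [AddCommGroup A] [Module R A] [AddCommGroup B] [Module R B]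
    [AddCommGroup D] [Module R D] (f : A →ₗ[R] B) (g : B →ₗ[R] D) : Prop where
  injective : Function.Injective f
  exact : Function.Exact f g
  surjective : Function.Surjective g

/-- `Ext^n(M, N) = 0` for all `n ≥ 1`. -/
def ExtVanish (R : Type u) [CommRing R] (M N : Type u) [AddCommGroup M] [Module R M]
    [AddCommGroup N] [Module R N] : Prop :=
  ∀ n : ℕ, 1 ≤ n → Subsingleton (Ext (ModuleCat.of R M) (ModuleCat.of R N) n)

/-- Every linear map `A → N` extends along `f : A → B`. -/
def Extends {A B : Type*} [AddCommGroup A] [Module R A] [AddCommGroup B] [Module R B]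
    (f : A →ₗ[R] B) (N : Type*) [AddCommGroup N] [Module R N] : Prop :=
  ∀ h : A →ₗ[R] N, ∃ k : B →ₗ[R] N, k ∘ₗ f = h

variable {A B D M N : Type u} [AddCommGroup A] [Module R A] [AddCommGroup B] [Module R B]
  [AddCommGroup D] [Module R D] [AddCommGroup M] [Module R M] [AddCommGroup N] [Module R N]
  {f : A →ₗ[R] B} {g : B →ₗ[R] D}

theorem IsShortExact.comp_eq_zero (h : IsShortExact f g) : g ∘ₗ f = 0 :=
  LinearMap.ext fun x => h.exact.apply_apply_eq_zero x

/-- A short exact sequence of linear maps as a short complex in `ModuleCat R`. -/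
abbrev IsShortExact.shortComplex (h : IsShortExact f g) : ShortComplex (ModuleCat.{u} R) :=
  ShortComplex.mk (ModuleCat.ofHom f) (ModuleCat.ofHom g)
    (by rw [← ModuleCat.ofHom_comp, h.comp_eq_zero]; rfl)

theorem IsShortExact.shortExact (h : IsShortExact f g) : h.shortComplex.ShortExact where
  exact := (ShortComplex.ShortExact.moduleCat_exact_iff_function_exact _).mpr h.exact
  mono_f := (ModuleCat.mono_iff_injective _).mpr h.injective
  epi_g := (ModuleCat.epi_iff_surjective _).mpr h.surjective

theorem IsShortExact.extends_of_ext_one (h : IsShortExact f g)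
    (hD : Subsingleton (Ext (ModuleCat.of R D) (ModuleCat.of R N) 1)) : Extends f N := by
  intro k
  obtain ⟨x, hx⟩ := Ext.contravariant_sequence_exact₁ h.shortExact (ModuleCat.of R N)
    (Ext.mk₀ (ModuleCat.ofHom k)) (add_zero 1) (Subsingleton.elim (h := hD) _ _)
  obtain ⟨y, rfl⟩ := Ext.addEquiv₀.symm.surjective x
  refine ⟨y.hom, ?_⟩
  have hx' : Ext.mk₀ (ModuleCat.ofHom f ≫ y) = Ext.mk₀ (ModuleCat.ofHom k) := by
    rw [← hx]; exact (Ext.mk₀_comp_mk₀ _ _).symm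
  have := congrArg ModuleCat.Hom.hom ((Ext.mk₀_bijective _ _).1 hx')
  exact this

theorem IsShortExact.ext_one_of_extends (h : IsShortExact f g) (he : Extends f N)
    (hB : Subsingleton (Ext (ModuleCat.of R B) (ModuleCat.of R N) 1)) :
    Subsingleton (Ext (ModuleCat.of R D) (ModuleCat.of R N) 1) := by
  refine subsingleton_of_forall_eq 0 fun x => ?_
  obtain ⟨y, rfl⟩ := Ext.contravariant_sequence_exact₃ h.shortExact (ModuleCat.of R N) x
    (Subsingleton.elim (h := hB) _ _) (add_zero 1)
  obtain ⟨z, rfl⟩ := Ext.addEquiv₀.symm.surjective y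
  obtain ⟨k, hk⟩ := he z.hom
  have hz : z = ModuleCat.ofHom f ≫ ModuleCat.ofHom k := by
    rw [← ModuleCat.ofHom_comp, hk]; rfl
  subst hz
  change h.shortExact.extClass.comp (Ext.mk₀ (h.shortComplex.f ≫ ModuleCat.ofHom k)) _ = 0
  rw [← Ext.mk₀_comp_mk₀, h.shortExact.extClass_comp_assoc]

theorem IsShortExact.ext_succ (h : IsShortExact f g) {n : ℕ}
    (hA : Subsingleton (Ext (ModuleCat.of R A) (ModuleCat.of R N) n))
    (hB : Subsingleton (Ext (ModuleCat.of R B) (ModuleCat.of R N) (n + 1))) :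
    Subsingleton (Ext (ModuleCat.of R D) (ModuleCat.of R N) (n + 1)) := by
  refine subsingleton_of_forall_eq 0 fun x => ?_
  obtain ⟨y, rfl⟩ := Ext.contravariant_sequence_exact₃ h.shortExact (ModuleCat.of R N) x
    (Subsingleton.elim (h := hB) _ _) (add_comm 1 n)
  rw [Subsingleton.elim (h := hA) y 0, Ext.comp_zero]

theorem IsShortExact.extVanish_right (h : IsShortExact f g) (hA : ExtVanish R A N)
    (hB : ExtVanish R B N) (he : Extends f N) : ExtVanish R D N
  | 0, hn => absurd hn (by simp)
  | 1, _ => h.ext_one_of_extends he (hB 1 le_rfl)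
  | n + 2, _ => h.ext_succ (hA _ (by simp)) (hB _ (by simp))

theorem IsShortExact.extVanish_middle (h : IsShortExact f g) (hA : ExtVanish R A N)
    (hD : ExtVanish R D N) : ExtVanish R B N := by
  intro n hn
  refine subsingleton_of_forall_eq 0 fun x => ?_
  obtain ⟨y, rfl⟩ := Ext.contravariant_sequence_exact₂ h.shortExact (ModuleCat.of R N) x
    (Subsingleton.elim (h := hA n hn) _ _)
  rw [Subsingleton.elim (h := hD n hn) y 0, Ext.comp_zero]

theorem IsShortExact.extVanish_left (h : IsShortExact f g) (hB : ExtVanish R B N)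
    (hD : ExtVanish R D N) : ExtVanish R A N := by
  intro n hn
  refine subsingleton_of_forall_eq 0 fun x => ?_
  obtain ⟨y, rfl⟩ := Ext.contravariant_sequence_exact₁ h.shortExact (ModuleCat.of R N) x
    (add_comm 1 n) (Subsingleton.elim (h := hD (n + 1) (by simp)) _ _)
  rw [Subsingleton.elim (h := hB n hn) y 0, Ext.comp_zero]

theorem extVanish_of_projective (hM : Module.Projective R M) : ExtVanish R M N := by
  intro n hn
  obtain ⟨n, rfl⟩ := Nat.exists_eq_succ_of_ne_zero (by lia : n ≠ 0)
  have : Projective (ModuleCat.of R M) := (IsProjective.iff_projective M).mp hM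
  exact Ext.subsingleton_of_projective _ _ _

theorem ExtVanish.of_retract_left (hM : ExtVanish R M N) (i : A →ₗ[R] M) (r : M →ₗ[R] A)
    (hr : r ∘ₗ i = LinearMap.id) : ExtVanish R A N := by
  intro n hn
  refine subsingleton_of_forall_eq 0 fun x => ?_
  have h1 : ModuleCat.ofHom i ≫ ModuleCat.ofHom r = 𝟙 (ModuleCat.of R A) := by
    rw [← ModuleCat.ofHom_comp, hr]; rfl
  rw [← Ext.mk₀_id_comp x, ← h1, ← Ext.mk₀_comp_mk₀_assoc,
    Subsingleton.elim (h := hM n hn) ((Ext.mk₀ (ModuleCat.ofHom r)).comp x (zero_add n)) 0,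
    Ext.comp_zero]

theorem ExtVanish.of_retract_right (hN : ExtVanish R M N) (i : A →ₗ[R] N) (r : N →ₗ[R] A)
    (hr : r ∘ₗ i = LinearMap.id) : ExtVanish R M A := by
  intro n hn
  refine subsingleton_of_forall_eq 0 fun x => ?_
  have h1 : ModuleCat.ofHom i ≫ ModuleCat.ofHom r = 𝟙 (ModuleCat.of R A) := by
    rw [← ModuleCat.ofHom_comp, hr]; rfl
  rw [← Ext.comp_mk₀_id x, ← h1, ← Ext.mk₀_comp_mk₀, ← Ext.comp_assoc_of_second_deg_zero,
    Subsingleton.elim (h := hN n hn) (x.comp (Ext.mk₀ (ModuleCat.ofHom i)) (add_zero n)) 0,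
    Ext.zero_comp]

theorem ExtVanish.of_equiv_left (hM : ExtVanish R M N) (e : A ≃ₗ[R] M) : ExtVanish R A N :=
  hM.of_retract_left (e : A →ₗ[R] M) e.symm (by ext; simp)

/-- A coinductive criterion for the vanishing of `Ext(-, N)`: dimension shifting inside a class of
modules that is closed under suitable syzygies. -/
theorem extVanish_of_syzygies (N : Type u) [AddCommGroup N] [Module R N]
    (𝒦 : ModuleCat.{u} R → Prop)
    (h𝒦 : ∀ M, 𝒦 M → ∃ (K P : ModuleCat.{u} R) (i : K →ₗ[R] P) (p : P →ₗ[R] M),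
      IsShortExact i p ∧ 𝒦 K ∧ ExtVanish R P N ∧ Extends i N)
    (M : ModuleCat.{u} R) (hM : 𝒦 M) : ExtVanish R M N := by
  have key : ∀ n : ℕ, ∀ M, 𝒦 M →
      Subsingleton (Ext (ModuleCat.of R M) (ModuleCat.of R N) (n + 1)) := by
    intro n
    induction n with
    | zero =>
      intro M hM
      obtain ⟨K, P, i, p, h, -, hP, he⟩ := h𝒦 M hM
      exact h.ext_one_of_extends he (hP 1 le_rfl)
    | succ n ih =>
      intro M hM
      obtain ⟨K, P, i, p, h, hK, hP, -⟩ := h𝒦 M hM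
      exact h.ext_succ (ih K hK) (hP _ (by simp))
  intro n hn
  obtain ⟨n, rfl⟩ := Nat.exists_eq_succ_of_ne_zero (by lia : n ≠ 0)
  exact key n M hM

/-- The canonical short exact sequence `0 → ker p → B → D → 0` of a surjection `p`. -/
theorem isShortExact_ker {B D : Type*} [AddCommGroup B] [Module R B] [AddCommGroup D] [Module R D]
    {p : B →ₗ[R] D} (hp : Function.Surjective p) :
    IsShortExact (LinearMap.ker p).subtype p :=
  ⟨Subtype.val_injective, by rw [LinearMap.exact_iff]; simp, hp⟩

theorem isShortExact_range {A B : Type*} [AddCommGroup A] [Module R A] [AddCommGroup B] [Module R B]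
    {i : A →ₗ[R] B} (hi : Function.Injective i) :
    IsShortExact i (LinearMap.range i).mkQ :=
  ⟨hi, by rw [LinearMap.exact_iff]; simp, Submodule.mkQ_surjective _⟩

theorem exists_free_cover (M : Type u) [AddCommGroup M] [Module R M] :
    ∃ (K F : ModuleCat.{u} R) (i : K →ₗ[R] F) (p : F →ₗ[R] M),
      Module.Free R F ∧ IsShortExact i p :=
  ⟨ModuleCat.of R _, ModuleCat.of R (M →₀ R), _, Finsupp.linearCombination R id,
    inferInstanceAs (Module.Free R (M →₀ R)),
    isShortExact_ker (Finsupp.linearCombination_id_surjective R M)⟩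

theorem IsShortExact.finsupp (h : IsShortExact f g) (S : Type u) :
    IsShortExact (Finsupp.mapRange.linearMap (α := S) f) (Finsupp.mapRange.linearMap g) := by
  refine ⟨Finsupp.mapRange_injective _ (map_zero f) h.injective, ?_,
    Finsupp.mapRange_surjective _ (map_zero g) h.surjective⟩
  intro y
  constructor
  · intro hy
    have h1 : ∀ s, ∃ a, f a = y s := fun s => (h.exact (y s)).1 (DFunLike.congr_fun hy s)
    choose a ha using h1
    refine ⟨Finsupp.onFinset y.support a fun s hs => ?_, ?_⟩
    · rw [Finsupp.mem_support_iff, ← ha]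
      exact fun h0 => hs (h.injective (by rw [h0, map_zero]))
    · ext s; exact ha s
  · rintro ⟨x, rfl⟩
    ext s
    exact h.exact.apply_apply_eq_zero (x s)

theorem Extends.finsupp (he : Extends f N) (S : Type u) :
    Extends (Finsupp.mapRange.linearMap (α := S) f) N := by
  intro h
  choose k hk using fun s => he (h ∘ₗ Finsupp.lsingle s)
  refine ⟨Finsupp.lsum R k, ?_⟩
  ext s a
  simpa using LinearMap.congr_fun (hk s) a

theorem ExtVanish.finsupp_left (hM : ExtVanish R M N) (S : Type u) : ExtVanish R (S →₀ M) N := by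
  refine extVanish_of_syzygies N
    (fun X => ∃ M : ModuleCat.{u} R, ExtVanish R M N ∧ X = ModuleCat.of R (S →₀ M)) ?_
    (ModuleCat.of R (S →₀ M)) ⟨ModuleCat.of R M, hM, rfl⟩
  rintro _ ⟨M, hM, rfl⟩
  obtain ⟨K, F, i, p, hF, h⟩ := exists_free_cover (R := R) M
  exact ⟨ModuleCat.of R (S →₀ K), ModuleCat.of R (S →₀ F),
    Finsupp.mapRange.linearMap i, Finsupp.mapRange.linearMap p, h.finsupp S,
    ⟨K, h.extVanish_left (extVanish_of_projective inferInstance) hM, rfl⟩,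
    extVanish_of_projective (Module.Projective.of_free (R := R) (P := S →₀ F)),
    (h.extends_of_ext_one (hM 1 le_rfl)).finsupp S⟩

end

/-! ### Constructions with short exact sequences -/

section

variable {R : Type u} [CommRing R]
variable {A B D K P I N X Y : Type u} [AddCommGroup A] [Module R A] [AddCommGroup B] [Module R B]
  [AddCommGroup D] [Module R D] [AddCommGroup K] [Module R K] [AddCommGroup P] [Module R P]
  [AddCommGroup I] [Module R I] [AddCommGroup N] [Module R N] [AddCommGroup X] [Module R X]
  [AddCommGroup Y] [Module R Y]
  {f : A →ₗ[R] B} {g : B →ₗ[R] D}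

theorem IsShortExact.exists_lift (h : IsShortExact f g) (k : X →ₗ[R] B) (hk : ∀ x, g (k x) = 0) :
    ∃ l : X →ₗ[R] A, ∀ x, f (l x) = k x := by
  refine ⟨(LinearEquiv.ofInjective f h.injective).symm ∘ₗ
    k.codRestrict (LinearMap.range f) fun x => (h.exact _).1 (hk x), fun x => ?_⟩
  exact congrArg Subtype.val ((LinearEquiv.ofInjective f h.injective).apply_symm_apply
    ⟨k x, (h.exact _).1 (hk x)⟩)

theorem IsShortExact.exists_desc (h : IsShortExact f g) (k : B →ₗ[R] X) (hk : ∀ a, k (f a) = 0) :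
    ∃ l : D →ₗ[R] X, ∀ b, l (g b) = k b := by
  have hle : LinearMap.ker g ≤ LinearMap.ker k := by
    intro b hb
    obtain ⟨a, rfl⟩ := (h.exact b).1 hb
    exact hk a
  refine ⟨(LinearMap.ker g).liftQ k hle ∘ₗ
    (g.quotKerEquivOfSurjective h.surjective).symm, fun b => ?_⟩
  have : (g.quotKerEquivOfSurjective h.surjective).symm (g b) = (LinearMap.ker g).mkQ b := by
    rw [LinearEquiv.symm_apply_eq]; rfl
  simp [this]

theorem IsShortExact.of_equiv_left (h : IsShortExact f g) (e : X ≃ₗ[R] A) :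
    IsShortExact (f ∘ₗ (e : X →ₗ[R] A)) g := by
  refine ⟨h.injective.comp e.injective, fun b => ?_, h.surjective⟩
  rw [h.exact b]
  constructor
  · rintro ⟨a, rfl⟩; exact ⟨e.symm a, by simp⟩
  · rintro ⟨a, rfl⟩; exact ⟨e a, rfl⟩

theorem IsShortExact.of_equiv_middle (h : IsShortExact f g) (e : B ≃ₗ[R] X) :
    IsShortExact ((e : B →ₗ[R] X) ∘ₗ f) (g ∘ₗ (e.symm : X →ₗ[R] B)) := by
  refine ⟨e.injective.comp h.injective, fun b => ?_, h.surjective.comp e.symm.surjective⟩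
  change g (e.symm b) = 0 ↔ _
  rw [h.exact (e.symm b)]
  constructor
  · rintro ⟨a, ha⟩; exact ⟨a, by simp [ha]⟩
  · rintro ⟨a, rfl⟩; exact ⟨a, by simp⟩

theorem IsShortExact.of_equiv_right (h : IsShortExact f g) (e : D ≃ₗ[R] X) :
    IsShortExact f ((e : D →ₗ[R] X) ∘ₗ g) := by
  refine ⟨h.injective, fun b => ?_, e.surjective.comp h.surjective⟩
  rw [← h.exact b]
  simp

theorem isShortExact_inl_snd : IsShortExact (LinearMap.inl R A B) (LinearMap.snd R A B) := by
  refine ⟨LinearMap.inl_injective, ?_, LinearMap.snd_surjective⟩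
  rintro ⟨a, b⟩
  constructor
  · rintro rfl; exact ⟨a, rfl⟩
  · rintro ⟨a, h⟩; rw [← h]; rfl

/-- If `0 → A → B → D → 0` and `0 → K → P → B → 0` are exact, then the kernel of `P → D` is an
extension of `A` by `K`. -/
theorem IsShortExact.exists_ker_comp (h : IsShortExact f g) {i : K →ₗ[R] P} {p : P →ₗ[R] B}
    (hP : IsShortExact i p) :
    ∃ (X : ModuleCat.{u} R) (j : X →ₗ[R] P) (u : K →ₗ[R] X) (v : X →ₗ[R] A),
      IsShortExact j (g ∘ₗ p) ∧ IsShortExact u v := by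
  have hX := isShortExact_ker (p := g ∘ₗ p) (h.surjective.comp hP.surjective)
  obtain ⟨u, hu⟩ := hX.exists_lift i fun x => by simp [hP.exact.apply_apply_eq_zero]
  obtain ⟨v, hv⟩ := h.exists_lift (p ∘ₗ (LinearMap.ker (g ∘ₗ p)).subtype) fun x => x.2
  refine ⟨ModuleCat.of R (LinearMap.ker (g ∘ₗ p)), (LinearMap.ker (g ∘ₗ p)).subtype, u, v, hX,
    ?_, ?_, ?_⟩
  · intro x y hxy
    exact hP.injective (by rw [← hu, ← hu, hxy])
  · intro x
    constructor
    · intro hx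
      have : p x.1 = 0 := by
        have := hv x
        rw [hx, map_zero] at this
        exact this.symm
      obtain ⟨k, hk⟩ := (hP.exact _).1 this
      exact ⟨k, hX.injective (by rw [hu, hk]; rfl)⟩
    · rintro ⟨k, rfl⟩
      apply h.injective
      rw [hv, map_zero]
      change p ((LinearMap.ker (g ∘ₗ p)).subtype (u k)) = 0
      rw [hu]
      exact hP.exact.apply_apply_eq_zero k
  · intro a
    obtain ⟨x, hx⟩ := hP.surjective (f a)
    refine ⟨⟨x, ?_⟩, h.injective ?_⟩
    · change g (p x) = 0
      rw [hx]; exact h.exact.apply_apply_eq_zero a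
    · rw [hv]; exact hx

/-- If `0 → A → B → D → 0` and `0 → B → I → N → 0` are exact, then the cokernel of `A → I` is an
extension of `N` by `D`. -/
theorem IsShortExact.exists_coker_comp (h : IsShortExact f g) {i : B →ₗ[R] I} {q : I →ₗ[R] N}
    (hI : IsShortExact i q) :
    ∃ (L : ModuleCat.{u} R) (r : I →ₗ[R] L) (u : D →ₗ[R] L) (v : L →ₗ[R] N),
      IsShortExact (i ∘ₗ f) r ∧ IsShortExact u v := by
  have hL := isShortExact_range (i := i ∘ₗ f) (hI.injective.comp h.injective)
  obtain ⟨u, hu⟩ := h.exists_desc ((LinearMap.range (i ∘ₗ f)).mkQ ∘ₗ i)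
    fun a => hL.exact.apply_apply_eq_zero a
  obtain ⟨v, hv⟩ := hL.exists_desc q fun a => hI.exact.apply_apply_eq_zero (f a)
  refine ⟨ModuleCat.of R _, _, u, v, hL, ?_, ?_, ?_⟩
  · rw [injective_iff_map_eq_zero]
    intro d hd
    obtain ⟨b, rfl⟩ := h.surjective d
    rw [hu] at hd
    obtain ⟨a, ha⟩ := (hL.exact _).1 hd
    rw [← hI.injective ha]
    exact h.exact.apply_apply_eq_zero a
  · intro l
    obtain ⟨x, rfl⟩ := hL.surjective l
    rw [hv, hI.exact x]
    constructor
    · rintro ⟨b, rfl⟩; exact ⟨g b, hu b⟩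
    · rintro ⟨d, hd⟩
      obtain ⟨b, rfl⟩ := h.surjective d
      rw [hu, ← sub_eq_zero] at hd
      obtain ⟨a, ha⟩ := (hL.exact (i b - x)).1 (by rw [map_sub]; exact hd)
      refine ⟨b - f a, ?_⟩
      rw [map_sub]
      change i (f a) = _ at ha
      rw [ha]; abel
  · intro n
    obtain ⟨x, rfl⟩ := hI.surjective n
    exact ⟨_, hv x⟩

/-- The pullback of `B → D` and `P → D`, seen as an extension in two ways. -/
theorem IsShortExact.exists_pullback (h : IsShortExact f g) {i : K →ₗ[R] P} {p : P →ₗ[R] D}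
    (hP : IsShortExact i p) :
    ∃ (X : ModuleCat.{u} R) (a : K →ₗ[R] X) (b : X →ₗ[R] B) (c : A →ₗ[R] X) (d : X →ₗ[R] P),
      IsShortExact a b ∧ IsShortExact c d := by
  let φ : B × P →ₗ[R] D := g ∘ₗ LinearMap.fst R B P - p ∘ₗ LinearMap.snd R B P
  have hφ : ∀ x : B × P, x ∈ LinearMap.ker φ ↔ g x.1 = p x.2 := fun x => by
    rw [LinearMap.mem_ker]; exact sub_eq_zero
  refine ⟨ModuleCat.of R (LinearMap.ker φ),
    (LinearMap.inr R B P ∘ₗ i).codRestrict _ fun k => ?_,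
    LinearMap.fst R B P ∘ₗ (LinearMap.ker φ).subtype,
    (LinearMap.inl R B P ∘ₗ f).codRestrict _ fun k => ?_,
    LinearMap.snd R B P ∘ₗ (LinearMap.ker φ).subtype, ⟨?_, ?_, ?_⟩, ⟨?_, ?_, ?_⟩⟩
  · rw [hφ]; simp [hP.exact.apply_apply_eq_zero]
  · rw [hφ]; simp [h.exact.apply_apply_eq_zero]
  · intro x y hxy
    exact hP.injective (congrArg (fun z : LinearMap.ker φ => z.1.2) hxy)
  · rintro ⟨⟨b, q⟩, hx⟩
    rw [hφ] at hx
    constructor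
    · rintro (rfl : b = 0)
      obtain ⟨k, rfl⟩ := (hP.exact q).1 (by rw [← hx]; simp)
      exact ⟨k, rfl⟩
    · rintro ⟨k, hk⟩
      exact (congrArg (fun z : LinearMap.ker φ => z.1.1) hk).symm
  · intro b
    obtain ⟨q, hq⟩ := hP.surjective (g b)
    exact ⟨⟨(b, q), (hφ _).2 hq.symm⟩, rfl⟩
  · intro x y hxy
    exact h.injective (congrArg (fun z : LinearMap.ker φ => z.1.1) hxy)
  · rintro ⟨⟨b, q⟩, hx⟩
    rw [hφ] at hx
    constructor
    · rintro (rfl : q = 0)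
      obtain ⟨k, rfl⟩ := (h.exact b).1 (by rw [hx]; simp)
      exact ⟨k, rfl⟩
    · rintro ⟨k, hk⟩
      exact (congrArg (fun z : LinearMap.ker φ => z.1.2) hk).symm
  · intro q
    obtain ⟨b, hb⟩ := h.surjective (p q)
    exact ⟨⟨(b, q), (hφ _).2 hb⟩, rfl⟩

variable {K' P' I' N' : Type u} [AddCommGroup K'] [Module R K'] [AddCommGroup P'] [Module R P']
  [AddCommGroup I'] [Module R I'] [AddCommGroup N'] [Module R N']

/-- The horseshoe lemma: covers of `A` and `D` combine to a cover of the extension `B`, and the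
kernels form a short exact sequence. -/
theorem IsShortExact.horseshoe (h : IsShortExact f g) {i : K →ₗ[R] P} {p : P →ₗ[R] A}
    (hA : IsShortExact i p) {i' : K' →ₗ[R] P'} {p' : P' →ₗ[R] D} (hD : IsShortExact i' p')
    (l : P' →ₗ[R] B) (hl : ∀ x, g (l x) = p' x) :
    ∃ (X : ModuleCat.{u} R) (j : X →ₗ[R] P × P') (q : P × P' →ₗ[R] B) (u : K →ₗ[R] X)
      (v : X →ₗ[R] K'), IsShortExact j q ∧ IsShortExact u v := by
  let φ : P × P' →ₗ[R] B := (f ∘ₗ p).coprod l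
  have hφ : ∀ x, φ x = f (p x.1) + l x.2 := fun x => rfl
  have hφs : Function.Surjective φ := by
    intro b
    obtain ⟨y, hy⟩ := hD.surjective (g b)
    obtain ⟨a, ha⟩ := (h.exact (b - l y)).1 (by rw [map_sub, hl, hy, sub_self])
    obtain ⟨x, rfl⟩ := hA.surjective a
    exact ⟨(x, y), by rw [hφ, ha]; abel⟩
  have hX := isShortExact_ker hφs
  obtain ⟨v, hv⟩ := hD.exists_lift (LinearMap.snd R P P' ∘ₗ (LinearMap.ker φ).subtype) (by
    rintro ⟨⟨x, y⟩, hxy⟩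
    have h1 : f (p x) + l y = 0 := hxy
    have h2 := congrArg g h1
    rw [map_add, h.exact.apply_apply_eq_zero, zero_add, hl, map_zero] at h2
    exact h2)
  refine ⟨ModuleCat.of R (LinearMap.ker φ), _, φ,
    (LinearMap.inl R P P' ∘ₗ i).codRestrict (LinearMap.ker φ) fun k => ?_, v, hX, ?_, ?_, ?_⟩
  · rw [LinearMap.mem_ker, hφ]; simp [hA.exact.apply_apply_eq_zero]
  · intro x y hxy
    exact hA.injective (congrArg (fun z : LinearMap.ker φ => z.1.1) hxy)
  · intro x
    constructor
    · intro hx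
      have h1 := hv x
      rw [hx, map_zero] at h1
      obtain ⟨⟨x, y⟩, hxy⟩ := x
      obtain rfl : 0 = y := h1
      have h2 : f (p x) + l 0 = 0 := hxy
      rw [map_zero, add_zero] at h2
      obtain ⟨k, rfl⟩ := (hA.exact x).1 (h.injective (h2.trans (map_zero f).symm))
      exact ⟨k, rfl⟩
    · rintro ⟨k, rfl⟩
      exact hD.injective ((hv _).trans (map_zero i').symm)
  · intro k
    obtain ⟨a, ha⟩ := (h.exact (l (i' k))).1 (by rw [hl, hD.exact.apply_apply_eq_zero])
    obtain ⟨x, hx⟩ := hA.surjective (-a)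
    refine ⟨⟨(x, i' k), ?_⟩, hD.injective ?_⟩
    · rw [LinearMap.mem_ker, hφ]; simp [hx, ha]
    · rw [hv]; rfl

/-- The dual horseshoe lemma: embeddings of `A` and `D` combine to an embedding of the
extension `B`, and the cokernels form a short exact sequence. -/
theorem IsShortExact.cohorseshoe (h : IsShortExact f g) {j : A →ₗ[R] I} {q : I →ₗ[R] N}
    (hA : IsShortExact j q) {j' : D →ₗ[R] I'} {q' : I' →ₗ[R] N'} (hD : IsShortExact j' q')
    (e : B →ₗ[R] I) (he : ∀ a, e (f a) = j a) :
    ∃ (X : ModuleCat.{u} R) (s : B →ₗ[R] I × I') (r : I × I' →ₗ[R] X) (u : N →ₗ[R] X)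
      (v : X →ₗ[R] N'), IsShortExact s r ∧ IsShortExact u v := by
  let ψ : B →ₗ[R] I × I' := e.prod (j' ∘ₗ g)
  have hψ : ∀ b, ψ b = (e b, j' (g b)) := fun b => rfl
  have hψi : Function.Injective ψ := by
    rw [injective_iff_map_eq_zero]
    intro b hb
    rw [hψ, Prod.mk_eq_zero] at hb
    obtain ⟨a, rfl⟩ := (h.exact b).1 (hD.injective (hb.2.trans (map_zero j').symm))
    rw [he] at hb
    rw [hA.injective (hb.1.trans (map_zero j).symm), map_zero]
  have hX := isShortExact_range hψi
  obtain ⟨u, hu⟩ := hA.exists_desc ((LinearMap.range ψ).mkQ ∘ₗ LinearMap.inl R I I') (by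
    intro a
    refine (hX.exact (j a, 0)).2 ⟨f a, ?_⟩
    rw [hψ, he, h.exact.apply_apply_eq_zero, map_zero])
  obtain ⟨v, hv⟩ := hX.exists_desc (q' ∘ₗ LinearMap.snd R I I') fun b =>
    hD.exact.apply_apply_eq_zero (g b)
  refine ⟨ModuleCat.of R ((I × I') ⧸ LinearMap.range ψ), ψ, _, u, v, hX, ?_, ?_, ?_⟩
  · rw [injective_iff_map_eq_zero]
    intro n hn
    obtain ⟨x, rfl⟩ := hA.surjective n
    rw [hu] at hn
    obtain ⟨b, hb⟩ := (hX.exact (x, 0)).1 hn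
    rw [hψ, Prod.mk.injEq] at hb
    obtain ⟨a, rfl⟩ := (h.exact b).1 (hD.injective (hb.2.trans (map_zero j').symm))
    rw [← hb.1, he, hA.exact.apply_apply_eq_zero]
  · intro z
    obtain ⟨⟨x, y⟩, rfl⟩ := hX.surjective z
    rw [hv]
    constructor
    · intro hy
      obtain ⟨d, rfl⟩ := (hD.exact y).1 hy
      obtain ⟨b, rfl⟩ := h.surjective d
      refine ⟨q (x - e b), ?_⟩
      rw [hu]
      have h1 := (hX.exact (ψ b)).2 ⟨b, rfl⟩
      have h2 : (x, j' (g b)) = LinearMap.inl R I I' (x - e b) + ψ b := by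
        rw [hψ]; simp
      rw [h2, map_add, h1, add_zero]; rfl
    · rintro ⟨n, hn⟩
      obtain ⟨w, rfl⟩ := hA.surjective n
      rw [hu] at hn
      have := congrArg v hn
      rw [hv] at this
      rw [← this]
      exact (hv (w, 0)).trans (map_zero q')
  · intro n
    obtain ⟨y, rfl⟩ := hD.surjective n
    exact ⟨_, hv (0, y)⟩

/-! ### Degreewise finite projective resolutions -/

theorem HasFiniteProjRes.exists_cover {M : Type u} [AddCommGroup M] [Module R M]
    (hM : HasFiniteProjRes R M) :
    ∃ (K P : ModuleCat.{u} R) (i : K →ₗ[R] P) (p : P →ₗ[R] M), Module.Projective R P ∧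
      Module.Finite R P ∧ IsShortExact i p ∧ HasFiniteProjRes R K := by
  obtain ⟨P, d, ε, hP, hP', hε, h0, hd⟩ := hM
  refine ⟨ModuleCat.of R (LinearMap.ker ε), P 0, (LinearMap.ker ε).subtype, ε, hP 0, hP' 0,
    isShortExact_ker hε, fun n => P (n + 1), fun n => d (n + 1),
    (d 0).codRestrict (LinearMap.ker ε) fun x => h0.apply_apply_eq_zero x,
    fun n => hP _, fun n => hP' _, ?_, ?_, fun n => hd _⟩
  · rintro ⟨x, hx⟩
    obtain ⟨y, rfl⟩ := (h0 x).1 hx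
    exact ⟨y, rfl⟩
  · intro x
    rw [← hd 0 x]
    exact Subtype.ext_iff

/-- A coinductive criterion: a class of modules that is closed under kernels of suitable
surjections from finitely generated projective modules consists of modules with degreewise finite
projective resolutions. -/
theorem hasFiniteProjRes_of_closed (𝓕 : ModuleCat.{u} R → Prop)
    (h𝓕 : ∀ M, 𝓕 M → ∃ (K P : ModuleCat.{u} R) (i : K →ₗ[R] P) (p : P →ₗ[R] M),
      Module.Projective R P ∧ Module.Finite R P ∧ IsShortExact i p ∧ 𝓕 K)
    (M : ModuleCat.{u} R) (hM : 𝓕 M) : HasFiniteProjRes R M := by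
  choose K P i p hP hP' h hK using h𝓕
  let s : ℕ → {M : ModuleCat.{u} R // 𝓕 M} := fun n =>
    Nat.rec ⟨M, hM⟩ (fun _ m => ⟨K m.1 m.2, hK m.1 m.2⟩) n
  refine ⟨fun n => P (s n).1 (s n).2, fun n => i (s n).1 (s n).2 ∘ₗ p (s (n + 1)).1 (s (n + 1)).2,
    p (s 0).1 (s 0).2, fun n => hP _ _, fun n => hP' _ _, (h _ _).surjective, ?_, ?_⟩
  · intro x
    rw [(h (s 0).1 (s 0).2).exact x]
    constructor
    · rintro ⟨y, rfl⟩
      obtain ⟨z, hz⟩ := (h (s 1).1 (s 1).2).surjective y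
      exact ⟨z, congrArg _ hz⟩
    · rintro ⟨z, rfl⟩; exact ⟨_, rfl⟩
  · intro n x
    have h1 : (i (s n).1 (s n).2 ∘ₗ p (s (n + 1)).1 (s (n + 1)).2) x = 0 ↔
        p (s (n + 1)).1 (s (n + 1)).2 x = 0 :=
      map_eq_zero_iff _ (h (s n).1 (s n).2).injective
    rw [h1, (h (s (n + 1)).1 (s (n + 1)).2).exact x]
    constructor
    · rintro ⟨y, rfl⟩
      obtain ⟨z, hz⟩ := (h (s (n + 2)).1 (s (n + 2)).2).surjective y
      exact ⟨z, congrArg _ hz⟩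
    · rintro ⟨z, rfl⟩; exact ⟨_, rfl⟩

theorem HasFiniteProjRes.of_cover {i : K →ₗ[R] P} {p : P →ₗ[R] A} (hP : Module.Projective R P)
    (hP' : Module.Finite R P) (h : IsShortExact i p) (hK : HasFiniteProjRes R K) :
    HasFiniteProjRes R A := by
  refine hasFiniteProjRes_of_closed (fun M => ∃ (K P : ModuleCat.{u} R) (i : K →ₗ[R] P)
    (p : P →ₗ[R] M), Module.Projective R P ∧ Module.Finite R P ∧ IsShortExact i p ∧
      HasFiniteProjRes R K) ?_ (ModuleCat.of R A)
    ⟨ModuleCat.of R K, ModuleCat.of R P, i, p, hP, hP', h, hK⟩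
  rintro M ⟨K, P, i, p, hP, hP', h, hK⟩
  exact ⟨K, P, i, p, hP, hP', h, hK.exists_cover⟩

theorem HasFiniteProjRes.finite (h : HasFiniteProjRes R A) : Module.Finite R A := by
  obtain ⟨K, P, i, p, hP, hP', h, hK⟩ := h.exists_cover
  exact Module.Finite.of_surjective p h.surjective

theorem HasFiniteProjRes.of_equiv (hA : HasFiniteProjRes R A) (e : A ≃ₗ[R] B) :
    HasFiniteProjRes R B := by
  obtain ⟨K, P, i, p, hP, hP', h, hK⟩ := hA.exists_cover
  exact .of_cover hP hP' (h.of_equiv_right e) hK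

theorem hasFiniteProjRes_of_projective (hP : Module.Projective R P) (hP' : Module.Finite R P) :
    HasFiniteProjRes R P := by
  refine hasFiniteProjRes_of_closed (fun M => Module.Projective R M ∧ Module.Finite R M) ?_
    (ModuleCat.of R P) ⟨hP, hP'⟩
  rintro M ⟨hM, hM'⟩
  exact ⟨ModuleCat.of R PUnit.{u + 1}, M, 0, LinearMap.id, hM, hM',
    ⟨fun _ _ _ => Subsingleton.elim _ _, fun x => ⟨fun hx => ⟨0, hx.symm⟩, by rintro ⟨_, rfl⟩; rfl⟩,
      fun x => ⟨x, rfl⟩⟩, inferInstanceAs (Module.Projective R PUnit.{u + 1}),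
    inferInstanceAs (Module.Finite R PUnit.{u + 1})⟩

theorem IsShortExact.hasFiniteProjRes_middle (h : IsShortExact f g) (hA : HasFiniteProjRes R A)
    (hD : HasFiniteProjRes R D) : HasFiniteProjRes R B := by
  refine hasFiniteProjRes_of_closed (fun B => ∃ (A D : ModuleCat.{u} R) (f : A →ₗ[R] B)
    (g : B →ₗ[R] D), IsShortExact f g ∧ HasFiniteProjRes R A ∧ HasFiniteProjRes R D) ?_
    (ModuleCat.of R B) ⟨ModuleCat.of R A, ModuleCat.of R D, f, g, h, hA, hD⟩
  rintro B ⟨A, D, f, g, h, hA, hD⟩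
  obtain ⟨K, P, i, p, hP, hP', hA', hK⟩ := hA.exists_cover
  obtain ⟨K', Q, i', p', hQ, hQ', hD', hK'⟩ := hD.exists_cover
  obtain ⟨l, hl⟩ := Module.projective_lifting_property g p' h.surjective
  obtain ⟨X, j, q, u, v, h1, h2⟩ := h.horseshoe hA' hD' l (LinearMap.congr_fun hl)
  exact ⟨X, ModuleCat.of R (P × Q), j, q, inferInstanceAs (Module.Projective R (P × Q)),
    inferInstanceAs (Module.Finite R (P × Q)), h1, K, K', u, v, h2, hK, hK'⟩

theorem IsShortExact.hasFiniteProjRes_right (h : IsShortExact f g) (hA : HasFiniteProjRes R A)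
    (hB : HasFiniteProjRes R B) : HasFiniteProjRes R D := by
  obtain ⟨K, P, i, p, hP, hP', h', hK⟩ := hB.exists_cover
  obtain ⟨X, j, u, v, h1, h2⟩ := h.exists_ker_comp h'
  exact .of_cover hP hP' h1 (h2.hasFiniteProjRes_middle hK hA)

theorem IsShortExact.exists_retraction (h : IsShortExact f g) (hD : Module.Projective R D) :
    ∃ r : B →ₗ[R] A, r ∘ₗ f = LinearMap.id := by
  obtain ⟨s, hs⟩ := Module.projective_lifting_property g LinearMap.id h.surjective
  obtain ⟨r, hr⟩ := h.exists_lift (LinearMap.id - s ∘ₗ g) fun x => by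
    have := LinearMap.congr_fun hs (g x)
    simp only [LinearMap.comp_apply, LinearMap.id_apply] at this
    simp [this]
  refine ⟨r, LinearMap.ext fun a => h.injective ?_⟩
  rw [LinearMap.comp_apply, hr]
  simp [h.exact.apply_apply_eq_zero]

/-- The split case: if `P` covers `B`, then the kernel of `P → D` is a direct summand of `P` and
covers `A` with the same kernel. -/
theorem IsShortExact.hasFiniteProjRes_left_of_projective (h : IsShortExact f g)
    (hB : HasFiniteProjRes R B) (hD : Module.Projective R D) : HasFiniteProjRes R A := by
  obtain ⟨K, P, i, p, hP, hP', h', hK⟩ := hB.exists_cover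
  obtain ⟨X, j, u, v, h1, h2⟩ := h.exists_ker_comp h'
  obtain ⟨r, hr⟩ := h1.exists_retraction hD
  exact .of_cover (Module.Projective.of_split j r hr)
    (Module.Finite.of_surjective r fun x => ⟨j x, LinearMap.congr_fun hr x⟩) h2 hK

/-- For a surjection `P → D` with `P` projective, the pullback of `B → D` and `P → D` is an
extension of `B` by a syzygy of `D` and an extension of `P` by `A`, which reduces to the split case. -/
theorem IsShortExact.hasFiniteProjRes_left (h : IsShortExact f g)
    (hB : HasFiniteProjRes R B) (hD : HasFiniteProjRes R D) : HasFiniteProjRes R A := by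
  obtain ⟨K, P, i, p, hP, hP', h', hK⟩ := hD.exists_cover
  obtain ⟨X, a, b, c, d, h1, h2⟩ := h.exists_pullback h'
  exact h2.hasFiniteProjRes_left_of_projective (h1.hasFiniteProjRes_middle hK hB) hP

end

/-! ### Cosyzygies of `G_C`-projective modules -/

section

variable {R : Type u} [CommRing R]

/-- `Ext^n(M, C ⊗ T) = 0` for all `n ≥ 1` and all projective modules `T`. -/
def IsLeftPerp (R : Type u) [CommRing R] (C : Type u) [AddCommGroup C] [Module R C]
    (M : Type u) [AddCommGroup M] [Module R M] : Prop :=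
  ∀ T : ModuleCat.{u} R, Module.Projective R T → ExtVanish R M (C ⊗[R] T)

variable {C : Type u} [AddCommGroup C] [Module R C]
variable {A B D M N E : Type u} [AddCommGroup A] [Module R A] [AddCommGroup B] [Module R B]
  [AddCommGroup D] [Module R D] [AddCommGroup M] [Module R M] [AddCommGroup N] [Module R N]
  [AddCommGroup E] [Module R E]

/-- For `T` projective, `C ⊗ T` is a retract of a direct sum of copies of `C`. -/
theorem exists_retract_tensor (C : Type u) [AddCommGroup C] [Module R C] (T : ModuleCat.{u} R)
    (hT : Module.Projective R T) :
    ∃ (S : Type u) (i : C ⊗[R] T →ₗ[R] (S →₀ C)) (r : (S →₀ C) →ₗ[R] C ⊗[R] T),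
      r ∘ₗ i = LinearMap.id := by
  classical
  obtain ⟨s, hs⟩ := (Module.projective_def' (R := R) (P := T)).1 hT
  let e := TensorProduct.finsuppScalarRight R R C T
  refine ⟨T, e.toLinearMap ∘ₗ s.lTensor C,
    (Finsupp.linearCombination R id).lTensor C ∘ₗ e.symm.toLinearMap, ?_⟩
  ext c t
  have := LinearMap.congr_fun hs t
  simp only [LinearMap.comp_apply, LinearMap.id_apply] at this
  simp [this]

/-- Extension of maps into `N` implies extension of maps into direct sums of copies of `N`, since a
map from a finitely generated module only meets finitely many summands. -/
theorem extends_finsupp_right {f : A →ₗ[R] B} (hA : Module.Finite R A) (he : Extends f N)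
    (S : Type u) : Extends f (S →₀ N) := by
  classical
  intro h
  obtain ⟨s, hs⟩ := hA.fg_top
  let F : Finset S := s.biUnion fun a => (h a).support
  have hF : ∀ a, (h a).support ⊆ F := by
    intro a
    have ha : a ∈ Submodule.span R (s : Set A) := by rw [hs]; trivial
    induction ha using Submodule.span_induction with
    | mem x hx => exact Finset.subset_biUnion_of_mem (fun a => (h a).support) hx
    | zero => simp
    | add x y _ _ hx hy =>
      rw [map_add]
      exact Finsupp.support_add.trans (Finset.union_subset hx hy)
    | smul r x _ hx =>
      rw [map_smul]
      exact Finsupp.support_smul.trans hx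
  choose k hk using fun t => he (Finsupp.lapply t ∘ₗ h)
  refine ⟨∑ t ∈ F, Finsupp.lsingle t ∘ₗ k t, ?_⟩
  ext a t
  have h1 : ∀ t, k t (f a) = h a t := fun t => LinearMap.congr_fun (hk t) a
  simp only [LinearMap.comp_apply, LinearMap.sum_apply, Finsupp.lsingle_apply, h1,
    Finsupp.finsetSum_apply, Finsupp.single_apply, Finset.sum_ite_eq']
  split_ifs with ht
  · rfl
  · by_contra h0
    exact ht (hF a (Finsupp.mem_support_iff.2 (Ne.symm h0)))

theorem ExtVanish.finsupp_right (hM : HasFiniteProjRes R M) (h : ExtVanish R M N) (S : Type u) :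
    ExtVanish R M (S →₀ N) := by
  refine extVanish_of_syzygies (S →₀ N)
    (fun M => HasFiniteProjRes R M ∧ ExtVanish R M N) ?_ (ModuleCat.of R M) ⟨hM, h⟩
  rintro M ⟨hM, h⟩
  obtain ⟨K, P, i, p, hP, hP', hip, hK⟩ := hM.exists_cover
  exact ⟨K, P, i, p, hip, ⟨hK, hip.extVanish_left (extVanish_of_projective hP) h⟩,
    extVanish_of_projective hP,
    extends_finsupp_right hK.finite (hip.extends_of_ext_one (h 1 le_rfl)) S⟩

/-- For modules with a degreewise finite projective resolution, `Ext(-, C ⊗ T)` vanishes for all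
projective `T` as soon as it does for `T = R`. -/
theorem isLeftPerp_of_hasFiniteProjRes (hM : HasFiniteProjRes R M) (h : ExtVanish R M C) :
    IsLeftPerp R C M := by
  intro T hT
  obtain ⟨S, i, r, hr⟩ := exists_retract_tensor C T hT
  exact (h.finsupp_right hM S).of_retract_right i r hr

theorem IsLeftPerp.finsupp (h : IsLeftPerp R C M) (S : Type u) : IsLeftPerp R C (S →₀ M) :=
  fun T hT => (h T hT).finsupp_left S

theorem IsLeftPerp.of_retract (h : IsLeftPerp R C M) (i : A →ₗ[R] M) (r : M →ₗ[R] A)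
    (hr : r ∘ₗ i = LinearMap.id) : IsLeftPerp R C A :=
  fun T hT => (h T hT).of_retract_left i r hr

theorem IsLeftPerp.of_equiv (h : IsLeftPerp R C M) (e : A ≃ₗ[R] M) : IsLeftPerp R C A :=
  fun T hT => (h T hT).of_equiv_left e

theorem isLeftPerp_of_projective (h : Module.Projective R M) : IsLeftPerp R C M :=
  fun _ _ => extVanish_of_projective h

theorem IsSemidualizing.isLeftPerp_tensor (hC : IsSemidualizing R C) (Q : ModuleCat.{u} R)
    (hQ : Module.Projective R Q) : IsLeftPerp R C (C ⊗[R] Q) := by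
  obtain ⟨S, i, r, hr⟩ := exists_retract_tensor C Q hQ
  exact ((isLeftPerp_of_hasFiniteProjRes hC.finiteProjRes hC.ext_eq_zero).finsupp S).of_retract
    i r hr

section

variable {f : A →ₗ[R] B} {g : B →ₗ[R] D}

theorem IsShortExact.isLeftPerp_left (h : IsShortExact f g) (hB : IsLeftPerp R C B)
    (hD : IsLeftPerp R C D) : IsLeftPerp R C A :=
  fun T hT => h.extVanish_left (hB T hT) (hD T hT)

theorem IsShortExact.isLeftPerp_middle (h : IsShortExact f g) (hA : IsLeftPerp R C A)
    (hD : IsLeftPerp R C D) : IsLeftPerp R C B :=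
  fun T hT => h.extVanish_middle (hA T hT) (hD T hT)

theorem IsShortExact.extends_of_isLeftPerp (h : IsShortExact f g) (hD : IsLeftPerp R C D)
    (T : ModuleCat.{u} R) (hT : Module.Projective R T) : Extends f (C ⊗[R] T) :=
  h.extends_of_ext_one (hD T hT 1 le_rfl)

theorem isShortExact_of_exact (h : Function.Exact f g) :
    IsShortExact (LinearMap.range f).subtype g.rangeRestrict := by
  refine ⟨Subtype.val_injective, fun x => ?_, g.surjective_rangeRestrict⟩
  rw [← Subtype.val_inj]
  refine (h x).trans ?_
  simp

/-- Exactness under `Hom(-, N)` says that maps into `N` extend from the image of `g` to its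
codomain. -/
theorem HomExact.extends_range (h : HomExact f g N) (h0 : g ∘ₗ f = 0) :
    Extends (LinearMap.range g).subtype N := by
  intro k
  have h1 : LinearMap.lcomp R N f (k ∘ₗ g.rangeRestrict) = 0 := by
    ext a
    have : g.rangeRestrict (f a) = 0 := Subtype.ext (LinearMap.congr_fun h0 a)
    simp [this]
  obtain ⟨l, hl⟩ := (h _).1 h1
  refine ⟨l, ?_⟩
  ext ⟨_, b, rfl⟩
  exact LinearMap.congr_fun hl b

theorem HomExact.range_subtype (h : HomExact f g N) :
    HomExact (LinearMap.range f).subtype g N := by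
  intro k
  rw [← h k]
  constructor
  · intro hk
    ext a
    exact LinearMap.congr_fun hk ⟨f a, a, rfl⟩
  · intro hk
    ext ⟨_, a, rfl⟩
    exact LinearMap.congr_fun hk a

theorem exact_range_subtype (h : Function.Exact f g) :
    Function.Exact (LinearMap.range f).subtype g := by
  intro x
  rw [h x]
  simp

theorem IsShortExact.exact_splice (h : IsShortExact f g) {p : E →ₗ[R] A} {i : D →ₗ[R] M}
    (hp : Function.Surjective p) (hi : Function.Injective i) :
    Function.Exact (f ∘ₗ p) (i ∘ₗ g) := by
  intro x
  rw [LinearMap.comp_apply, map_eq_zero_iff _ hi, h.exact x]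
  constructor
  · rintro ⟨a, rfl⟩
    obtain ⟨e, rfl⟩ := hp a
    exact ⟨e, rfl⟩
  · rintro ⟨e, rfl⟩
    exact ⟨p e, rfl⟩

theorem IsShortExact.homExact_splice (h : IsShortExact f g) {p : E →ₗ[R] A} {i : D →ₗ[R] M}
    (hp : Function.Surjective p) (hi : Extends i N) : HomExact (f ∘ₗ p) (i ∘ₗ g) N := by
  intro k
  constructor
  · intro hk
    obtain ⟨l, hl⟩ := h.exists_desc k fun a => by
      obtain ⟨e, rfl⟩ := hp a
      exact LinearMap.congr_fun hk e
    obtain ⟨m, hm⟩ := hi l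
    refine ⟨m, ?_⟩
    ext b
    exact (LinearMap.congr_fun hm (g b)).trans (hl b)
  · rintro ⟨m, rfl⟩
    ext e
    have : g (f (p e)) = 0 := h.exact.apply_apply_eq_zero _
    simp [this]

end

/-- A class of modules is cosyzygy closed if each of its members `N` satisfies
`Ext^n(N, C ⊗ T) = 0` for `n ≥ 1` and `T` projective, and embeds into some `C ⊗ Q` with `Q`
projective in such a way that the cokernel lies in the class again. -/
def IsCosyzygyClosed (R : Type u) [CommRing R] (C : Type u) [AddCommGroup C] [Module R C]
    (𝒢 : ModuleCat.{u} R → Prop) : Prop :=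
  ∀ N, 𝒢 N → IsLeftPerp R C N ∧ ∃ (Q N' : ModuleCat.{u} R) (j : N →ₗ[R] C ⊗[R] Q)
    (q : C ⊗[R] Q →ₗ[R] N'), Module.Projective R Q ∧ IsShortExact j q ∧ 𝒢 N'

/-- Members of cosyzygy closed classes are `G_C`-projective: splice a free resolution with the
successive embeddings. -/
theorem isGCProjective_of_closed (𝒢 : ModuleCat.{u} R → Prop) (h𝒢 : IsCosyzygyClosed R C 𝒢)
    (M : ModuleCat.{u} R) (hM : 𝒢 M) : IsGCProjective R C M := by
  choose hW Q N' j q hQ hjq hN' using h𝒢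
  choose K F i p hF hip using fun M : ModuleCat.{u} R => exists_free_cover (R := R) M
  have hK : ∀ M : ModuleCat.{u} R, IsLeftPerp R C M → IsLeftPerp R C (K M) := fun M hM =>
    have := hF M
    (hip M).isLeftPerp_left (isLeftPerp_of_projective inferInstance) hM
  let s : ℕ → {M : ModuleCat.{u} R // IsLeftPerp R C M} := fun n =>
    Nat.rec ⟨M, hW M hM⟩ (fun _ m => ⟨K m.1, hK m.1 m.2⟩) n
  let t : ℕ → {M : ModuleCat.{u} R // 𝒢 M} := fun n =>
    Nat.rec ⟨M, hM⟩ (fun _ m => ⟨N' m.1 m.2, hN' m.1 m.2⟩) n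
  refine ⟨{
    P := fun n => F (s n).1
    Q := fun n => Q (t n).1 (t n).2
    projective_P := fun n => by have := hF (s n).1; infer_instance
    projective_Q := fun n => hQ _ _
    dP := fun n => i (s n).1 ∘ₗ p (s (n + 1)).1
    dPQ := j (t 0).1 (t 0).2 ∘ₗ p (s 0).1
    dQ := fun n => j (t (n + 1)).1 (t (n + 1)).2 ∘ₗ q (t n).1 (t n).2
    exact_P_succ := fun n => (hip (s (n + 1)).1).exact_splice (hip (s (n + 2)).1).surjective
      (hip (s n).1).injective
    exact_P_zero := (hip (s 0).1).exact_splice (hip (s 1).1).surjective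
      (hjq (t 0).1 (t 0).2).injective
    exact_Q_zero := (hjq (t 0).1 (t 0).2).exact_splice (hip (s 0).1).surjective
      (hjq (t 1).1 (t 1).2).injective
    exact_Q_succ := fun n => (hjq (t (n + 1)).1 (t (n + 1)).2).exact_splice
      (hjq (t n).1 (t n).2).surjective (hjq (t (n + 2)).1 (t (n + 2)).2).injective
    homExact_P_succ := fun T hT n => (hip (s (n + 1)).1).homExact_splice
      (hip (s (n + 2)).1).surjective ((hip (s n).1).extends_of_isLeftPerp (s n).2 T hT)
    homExact_P_zero := fun T hT => (hip (s 0).1).homExact_splice (hip (s 1).1).surjective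
      ((hjq (t 0).1 (t 0).2).extends_of_isLeftPerp (hW _ (t 1).2) T hT)
    homExact_Q_zero := fun T hT => (hjq (t 0).1 (t 0).2).homExact_splice
      (hip (s 0).1).surjective
      ((hjq (t 1).1 (t 1).2).extends_of_isLeftPerp (hW _ (t 2).2) T hT)
    homExact_Q_succ := fun T hT n => (hjq (t (n + 1)).1 (t (n + 1)).2).homExact_splice
      (hjq (t n).1 (t n).2).surjective
      ((hjq (t (n + 2)).1 (t (n + 2)).2).extends_of_isLeftPerp (hW _ (t (n + 3)).2) T hT) }, ⟨?_⟩⟩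
  have hker : LinearMap.ker (p (s 0).1) = LinearMap.range (i (s 0).1 ∘ₗ p (s 1).1) := by
    have h1 : Function.Exact (i (s 0).1 ∘ₗ p (s 1).1) (LinearMap.id ∘ₗ p (s 0).1) :=
      (hip (s 0).1).exact_splice (hip (s 1).1).surjective Function.injective_id
    exact h1.linearMap_ker_eq
  exact ((p (s 0).1).quotKerEquivOfSurjective (hip (s 0).1).surjective).symm.trans
    (Submodule.quotEquivOfEq _ _ hker)

/-- The right half of a complete `PC`-resolution, started at a module `N` with
`Ext^n(N, C ⊗ T) = 0` for `n ≥ 1` and `T` projective. -/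
structure IsCoresolved (C : Type u) [AddCommGroup C] [Module R C] (N : ModuleCat.{u} R)
    (Q : ℕ → ModuleCat.{u} R) (j : N →ₗ[R] C ⊗[R] Q 0)
    (d : ∀ n, C ⊗[R] Q n →ₗ[R] C ⊗[R] Q (n + 1)) : Prop where
  isLeftPerp : IsLeftPerp R C N
  projective : ∀ n, Module.Projective R (Q n)
  injective : Function.Injective j
  extend : ∀ T : ModuleCat.{u} R, Module.Projective R T → Extends j (C ⊗[R] T)
  exact_zero : Function.Exact j (d 0)
  exact_succ : ∀ n, Function.Exact (d n) (d (n + 1))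
  homExact_zero : ∀ T : ModuleCat.{u} R, Module.Projective R T → HomExact j (d 0) (C ⊗[R] T)
  homExact_succ : ∀ T : ModuleCat.{u} R, Module.Projective R T →
    ∀ n, HomExact (d n) (d (n + 1)) (C ⊗[R] T)

theorem IsSemidualizing.isCosyzygyClosed_isCoresolved (hC : IsSemidualizing R C) :
    IsCosyzygyClosed R C (fun N => ∃ Q j d, IsCoresolved C N Q j d) := by
  rintro N ⟨Q, j, d, h⟩
  refine ⟨h.isLeftPerp, Q 0, ModuleCat.of R (LinearMap.range (d 0)), j, (d 0).rangeRestrict,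
    h.projective 0, ?_, fun n => Q (n + 1), (LinearMap.range (d 0)).subtype, fun n => d (n + 1), ?_⟩
  · refine ⟨h.injective, fun x => ?_, (d 0).surjective_rangeRestrict⟩
    rw [← h.exact_zero x, ← Subtype.val_inj]; rfl
  · have hS : IsShortExact j (d 0).rangeRestrict := by
      refine ⟨h.injective, fun x => ?_, (d 0).surjective_rangeRestrict⟩
      rw [← h.exact_zero x, ← Subtype.val_inj]; rfl
    exact {
      isLeftPerp := fun T hT => hS.extVanish_right (h.isLeftPerp T hT)
        (hC.isLeftPerp_tensor (Q 0) (h.projective 0) T hT) (h.extend T hT)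
      projective := fun n => h.projective _
      injective := Subtype.val_injective
      extend := fun T hT => (h.homExact_zero T hT).extends_range h.exact_zero.linearMap_comp_eq_zero
      exact_zero := exact_range_subtype (h.exact_succ 0)
      exact_succ := fun n => h.exact_succ _
      homExact_zero := fun T hT => (h.homExact_succ T hT 0).range_subtype
      homExact_succ := fun T hT n => h.homExact_succ T hT _ }

/-- The vanishing of `Ext` comes from the left half of the resolution, by dimension shifting along
the images of the maps `dP n`. -/
theorem CompletePCResolution.isLeftPerp_range (X : CompletePCResolution R C) :
    IsLeftPerp R C (LinearMap.range X.dPQ) := by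
  intro T hT
  have h1 : ExtVanish R (LinearMap.range (X.dP 0)) (C ⊗[R] T) := by
    refine extVanish_of_syzygies (C ⊗[R] T)
      (fun K => ∃ n, K = ModuleCat.of R (LinearMap.range (X.dP n))) ?_
      (ModuleCat.of R (LinearMap.range (X.dP 0))) ⟨0, rfl⟩
    rintro _ ⟨n, rfl⟩
    exact ⟨ModuleCat.of R (LinearMap.range (X.dP (n + 1))), X.P (n + 1), _, _,
      isShortExact_of_exact (X.exact_P_succ n), ⟨n + 1, rfl⟩,
      extVanish_of_projective (X.projective_P _),
      (X.homExact_P_succ T hT (n + 1)).extends_range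
        (X.exact_P_succ (n + 1)).linearMap_comp_eq_zero⟩
  exact (isShortExact_of_exact X.exact_P_zero).extVanish_right h1
    (extVanish_of_projective (X.projective_P 0))
    ((X.homExact_P_succ T hT 0).extends_range (X.exact_P_succ 0).linearMap_comp_eq_zero)

theorem IsSemidualizing.exists_closed (hC : IsSemidualizing R C) (hM : IsGCProjective R C M) :
    ∃ (𝒢 : ModuleCat.{u} R → Prop) (N : ModuleCat.{u} R), IsCosyzygyClosed R C 𝒢 ∧ 𝒢 N ∧
      Nonempty (M ≃ₗ[R] N) := by
  obtain ⟨X, ⟨e⟩⟩ := hM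
  refine ⟨_, ModuleCat.of R (LinearMap.range X.dPQ), hC.isCosyzygyClosed_isCoresolved,
    ⟨X.Q, (LinearMap.range X.dPQ).subtype, X.dQ, {
      isLeftPerp := X.isLeftPerp_range
      projective := X.projective_Q
      injective := Subtype.val_injective
      extend := fun T hT =>
        (X.homExact_P_zero T hT).extends_range X.exact_P_zero.linearMap_comp_eq_zero
      exact_zero := exact_range_subtype X.exact_Q_zero
      exact_succ := X.exact_Q_succ
      homExact_zero := fun T hT => (X.homExact_Q_zero T hT).range_subtype
      homExact_succ := X.homExact_Q_succ }⟩, ⟨?_⟩⟩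
  exact e.trans ((Submodule.quotEquivOfEq _ _ X.exact_P_zero.linearMap_ker_eq.symm).trans
    X.dPQ.quotKerEquivRange)

theorem IsSemidualizing.isLeftPerp (hC : IsSemidualizing R C) (hM : IsGCProjective R C M) :
    IsLeftPerp R C M := by
  obtain ⟨𝒢, N, h𝒢, hN, ⟨e⟩⟩ := hC.exists_closed hM
  exact (h𝒢 N hN).1.of_equiv e

/-- Together with `IsSemidualizing.isLeftPerp`: the `G_C`-projective modules form a cosyzygy closed
class. -/
theorem IsSemidualizing.exists_cosyzygy (hC : IsSemidualizing R C) (hM : IsGCProjective R C M) :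
    ∃ (Q N : ModuleCat.{u} R) (j : M →ₗ[R] C ⊗[R] Q) (q : C ⊗[R] Q →ₗ[R] N),
      Module.Projective R Q ∧ IsShortExact j q ∧ IsGCProjective R C N := by
  obtain ⟨𝒢, N, h𝒢, hN, ⟨e⟩⟩ := hC.exists_closed hM
  obtain ⟨-, Q, N', j, q, hQ, hjq, hN'⟩ := h𝒢 N hN
  exact ⟨Q, N', j ∘ₗ (e : M →ₗ[R] N), q, hQ, hjq.of_equiv_left e,
    isGCProjective_of_closed 𝒢 h𝒢 N' hN'⟩

end

/-! ### Closure properties of `G_C`-projective modules -/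

section

variable {R : Type u} [CommRing R] {C : Type u} [AddCommGroup C] [Module R C]
variable {A B D M N K X : Type u} [AddCommGroup A] [Module R A] [AddCommGroup B] [Module R B]
  [AddCommGroup D] [Module R D] [AddCommGroup M] [Module R M] [AddCommGroup N] [Module R N]
  [AddCommGroup K] [Module R K] [AddCommGroup X] [Module R X]
  {f : A →ₗ[R] B} {g : B →ₗ[R] D}

theorem IsGCProjective.of_equiv (hA : IsGCProjective R C A) (e : B ≃ₗ[R] A) :
    IsGCProjective R C B := by
  obtain ⟨X, ⟨e'⟩⟩ := hA
  exact ⟨X, ⟨e.trans e'⟩⟩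

theorem IsSemidualizing.isGCProjective_of_cosyzygy (hC : IsSemidualizing R C)
    (hM : IsLeftPerp R C M) {Q : ModuleCat.{u} R} (hQ : Module.Projective R Q)
    {j : M →ₗ[R] C ⊗[R] Q} {q : C ⊗[R] Q →ₗ[R] N} (h : IsShortExact j q)
    (hN : IsGCProjective R C N) : IsGCProjective R C M := by
  refine isGCProjective_of_closed (fun M => IsLeftPerp R C M ∧ ∃ (Q N : ModuleCat.{u} R)
    (j : M →ₗ[R] C ⊗[R] Q) (q : C ⊗[R] Q →ₗ[R] N), Module.Projective R Q ∧ IsShortExact j q ∧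
      IsGCProjective R C N) ?_ (ModuleCat.of R M) ⟨hM, Q, ModuleCat.of R N, j, q, hQ, h, hN⟩
  rintro M ⟨hM, Q, N, j, q, hQ, h, hN⟩
  exact ⟨hM, Q, N, j, q, hQ, h, hC.isLeftPerp hN, hC.exists_cosyzygy hN⟩

theorem IsSemidualizing.isGCProjective_middle (hC : IsSemidualizing R C) (h : IsShortExact f g)
    (hA : IsGCProjective R C A) (hD : IsGCProjective R C D) : IsGCProjective R C B := by
  refine isGCProjective_of_closed (fun B => ∃ (A D : ModuleCat.{u} R) (f : A →ₗ[R] B)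
    (g : B →ₗ[R] D), IsShortExact f g ∧ IsGCProjective R C A ∧ IsGCProjective R C D) ?_
    (ModuleCat.of R B) ⟨ModuleCat.of R A, ModuleCat.of R D, f, g, h, hA, hD⟩
  rintro B ⟨A, D, f, g, h, hA, hD⟩
  refine ⟨h.isLeftPerp_middle (hC.isLeftPerp hA) (hC.isLeftPerp hD), ?_⟩
  obtain ⟨Q, N, j, q, hQ, hjq, hN⟩ := hC.exists_cosyzygy hA
  obtain ⟨Q', N', j', q', hQ', hjq', hN'⟩ := hC.exists_cosyzygy hD
  obtain ⟨e, he⟩ := h.extends_of_isLeftPerp (hC.isLeftPerp hD) Q hQ j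
  obtain ⟨X, s, r, u, v, h1, h2⟩ := h.cohorseshoe hjq hjq' e (LinearMap.congr_fun he)
  exact ⟨ModuleCat.of R (Q × Q'), X, _, _, inferInstanceAs (Module.Projective R (Q × Q')),
    h1.of_equiv_middle (TensorProduct.prodRight R R C Q Q').symm, N, N', u, v, h2, hN, hN'⟩

/-- The cokernel of the composite `A → B → C ⊗ Q` is an extension of a cosyzygy of `B` by `D`. -/
theorem IsSemidualizing.isGCProjective_left (hC : IsSemidualizing R C) (h : IsShortExact f g)
    (hB : IsGCProjective R C B) (hD : IsGCProjective R C D) : IsGCProjective R C A := by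
  obtain ⟨Q, N, j, q, hQ, hjq, hN⟩ := hC.exists_cosyzygy hB
  obtain ⟨L, r, u, v, h1, h2⟩ := h.exists_coker_comp hjq
  exact hC.isGCProjective_of_cosyzygy
    (h.isLeftPerp_left (hC.isLeftPerp hB) (hC.isLeftPerp hD)) hQ h1
    (hC.isGCProjective_middle h2 hD hN)

/-- If `0 → A × B → C ⊗ Q → N → 0` is exact with `N` a `G_C`-projective module, then the cokernel
`L` of `A → C ⊗ Q` is an extension of `N` by `B`, hence `L × A` is an extension of `N` by `A × B`.
So the class of direct factors of `G_C`-projective modules is cosyzygy closed. -/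
theorem IsSemidualizing.isGCProjective_of_prod (hC : IsSemidualizing R C)
    (h : IsGCProjective R C (A × B)) : IsGCProjective R C A := by
  refine isGCProjective_of_closed
    (fun A => ∃ B : ModuleCat.{u} R, IsGCProjective R C (A × B)) ?_
    (ModuleCat.of R A) ⟨ModuleCat.of R B, h⟩
  rintro A ⟨B, h⟩
  refine ⟨(hC.isLeftPerp h).of_retract (LinearMap.inl R A B) (LinearMap.fst R A B)
    (by ext; rfl), ?_⟩
  obtain ⟨Q, N, j, q, hQ, hjq, hN⟩ := hC.exists_cosyzygy h
  obtain ⟨L, r, u, v, h1, h2⟩ := (isShortExact_inl_snd (R := R) (A := A) (B := B)).exists_coker_comp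
    hjq
  refine ⟨Q, L, _, r, hQ, h1, A, ?_⟩
  have h3 : IsShortExact ((u ∘ₗ LinearMap.snd R A B).prod (LinearMap.fst R A B))
      (v ∘ₗ LinearMap.fst R L A) := by
    refine ⟨?_, ?_, h2.surjective.comp LinearMap.fst_surjective⟩
    · rintro ⟨a, b⟩ ⟨a', b'⟩ hab
      obtain ⟨h4, h5⟩ := Prod.mk.inj hab
      exact Prod.ext h5 (h2.injective h4)
    · rintro ⟨l, a⟩
      refine (h2.exact l).trans ⟨?_, ?_⟩
      · rintro ⟨b, rfl⟩; exact ⟨(a, b), rfl⟩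
      · rintro ⟨⟨a, b⟩, hab⟩; exact ⟨b, congrArg Prod.fst hab⟩
  exact hC.isGCProjective_middle h3 h hN

theorem IsSemidualizing.isGCProjective_of_retract (hC : IsSemidualizing R C)
    (hM : IsGCProjective R C M) (i : A →ₗ[R] M) (r : M →ₗ[R] A) (hr : r ∘ₗ i = LinearMap.id) :
    IsGCProjective R C A := by
  have hri : ∀ a, r (i a) = a := LinearMap.congr_fun hr
  let e : (A × LinearMap.ker r) ≃ₗ[R] M := LinearEquiv.ofBijective
    (i.coprod (LinearMap.ker r).subtype) (by
      constructor
      · rw [injective_iff_map_eq_zero]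
        rintro ⟨a, x, hx⟩ h
        have h1 : i a + x = 0 := h
        obtain rfl : a = 0 := by
          have := congrArg r h1
          rwa [map_add, hri, LinearMap.mem_ker.1 hx, add_zero, map_zero] at this
        obtain rfl : x = 0 := by simpa using h1
        rfl
      · intro m
        exact ⟨(r m, ⟨m - i (r m), by simp [hri]⟩), by simp⟩)
  exact hC.isGCProjective_of_prod (hM.of_equiv e)

theorem projective_finsupp (S : Type u) (hM : Module.Projective R M) :
    Module.Projective R (S →₀ M) := by
  obtain ⟨s, hs⟩ := (Module.projective_def' (R := R) (P := M)).1 hM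
  refine Module.Projective.of_split (M := S →₀ (M →₀ R)) (Finsupp.mapRange.linearMap s)
    (Finsupp.mapRange.linearMap (Finsupp.linearCombination R id)) ?_
  rw [← Finsupp.mapRange.linearMap_comp, hs, Finsupp.mapRange.linearMap_id]

theorem IsSemidualizing.isGCProjective_finsupp (hC : IsSemidualizing R C)
    (hM : IsGCProjective R C M) (S : Type u) : IsGCProjective R C (S →₀ M) := by
  classical
  refine isGCProjective_of_closed
    (fun X => ∃ M : ModuleCat.{u} R, IsGCProjective R C M ∧ X = ModuleCat.of R (S →₀ M)) ?_
    (ModuleCat.of R (S →₀ M)) ⟨ModuleCat.of R M, hM, rfl⟩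
  rintro _ ⟨M, hM, rfl⟩
  obtain ⟨Q, N, j, q, hQ, hjq, hN⟩ := hC.exists_cosyzygy hM
  exact ⟨(hC.isLeftPerp hM).finsupp S, ModuleCat.of R (S →₀ Q), ModuleCat.of R (S →₀ N), _, _,
    projective_finsupp S hQ,
    (hjq.finsupp S).of_equiv_middle (TensorProduct.finsuppRight R R C Q S).symm, N, hN, rfl⟩

/-! ### The ring is `G_C`-projective -/

/-- `X` is reflexive with respect to `C`: the evaluation `X → Hom(Hom(X, C), C)` is bijective. -/
def IsBidual (R : Type u) [CommRing R] (C X : Type u) [AddCommGroup C] [Module R C]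
    [AddCommGroup X] [Module R X] : Prop :=
  Function.Bijective (LinearMap.applyₗ : X →ₗ[R] (X →ₗ[R] C) →ₗ[R] C)

theorem IsSemidualizing.exists_smul (hC : IsSemidualizing R C) (φ : C →ₗ[R] C) :
    ∃ r : R, ∀ c, φ c = r • c := by
  obtain ⟨r, rfl⟩ := hC.homothety_bijective.2 φ
  exact ⟨r, fun c => rfl⟩

theorem IsSemidualizing.isBidual_self (hC : IsSemidualizing R C) : IsBidual R C C := by
  constructor
  · intro x y h
    exact LinearMap.congr_fun h LinearMap.id
  · intro k
    refine ⟨k LinearMap.id, ?_⟩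
    ext φ
    obtain ⟨r, hr⟩ := hC.exists_smul φ
    obtain rfl : φ = r • LinearMap.id := LinearMap.ext hr
    simp

theorem IsSemidualizing.isBidual_fin (hC : IsSemidualizing R C) (n : ℕ) :
    IsBidual R C (Fin n → R) := by
  constructor
  · intro x y h
    ext i
    refine hC.homothety_bijective.1 (LinearMap.ext fun c => ?_)
    exact LinearMap.congr_fun h ((LinearMap.toSpanSingleton R C c) ∘ₗ LinearMap.proj i)
  · intro k
    -- `ι i c` is the functional `v ↦ v i • c`.
    let ι : Fin n → C →ₗ[R] ((Fin n → R) →ₗ[R] C) := fun i =>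
      LinearMap.lcomp R C (LinearMap.proj i) ∘ₗ (LinearMap.ringLmapEquivSelf R R C).symm.toLinearMap
    have hι : ∀ i c v, ι i c v = v i • c := fun i c v => rfl
    choose r hr using fun i => hC.exists_smul (k ∘ₗ ι i)
    refine ⟨r, ?_⟩
    ext φ
    have hφ : φ = ∑ i, ι i (φ (Pi.single i 1)) := by
      ext i
      simp [hι, Pi.single_apply]
    have h1 : ∀ i c, k (ι i c) = r i • c := hr
    conv_rhs => rw [hφ, map_sum]
    simp only [h1]
    change φ r = _
    conv_lhs => rw [hφ, LinearMap.sum_apply]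
    simp only [hι]

theorem HasFiniteProjRes.exists_fin_cover (hX : HasFiniteProjRes R X) :
    ∃ (n : ℕ) (K : ModuleCat.{u} R) (i : K →ₗ[R] (Fin n → R)) (p : (Fin n → R) →ₗ[R] X),
      IsShortExact i p ∧ HasFiniteProjRes R K := by
  have := hX.finite
  obtain ⟨n, p, hp⟩ := Module.Finite.exists_fin' R X
  have h := isShortExact_ker hp
  exact ⟨n, ModuleCat.of R (LinearMap.ker p), _, p, h,
    h.hasFiniteProjRes_left (hasFiniteProjRes_of_projective inferInstance inferInstance) hX⟩

theorem IsShortExact.dual (h : IsShortExact f g) (he : Extends f N) :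
    IsShortExact (LinearMap.lcomp R N g) (LinearMap.lcomp R N f) := by
  refine ⟨?_, ?_, he⟩
  · intro x y hxy
    ext d
    obtain ⟨b, rfl⟩ := h.surjective d
    exact LinearMap.congr_fun hxy b
  · intro k
    constructor
    · intro hk
      obtain ⟨l, hl⟩ := h.exists_desc k (LinearMap.congr_fun hk)
      exact ⟨l, LinearMap.ext hl⟩
    · rintro ⟨l, rfl⟩
      ext a
      simp [h.exact.apply_apply_eq_zero]

/-- Reflexivity with respect to `C` passes to syzygies `A` in `0 → A → B → D → 0` as long as every
map `A → C` extends to `B`. -/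
theorem IsShortExact.isBidual_left (h : IsShortExact f g) (he : Extends f C)
    (hB : IsBidual R C B) (hD : IsBidual R C D) : IsBidual R C A := by
  constructor
  · intro x y hxy
    refine h.injective (hB.1 (LinearMap.ext fun φ => ?_))
    exact LinearMap.congr_fun hxy (φ ∘ₗ f)
  · intro k
    obtain ⟨b, hb⟩ := hB.2 (k ∘ₗ LinearMap.lcomp R C f)
    have hb' : ∀ φ : B →ₗ[R] C, φ b = k (φ ∘ₗ f) := LinearMap.congr_fun hb
    have hgb : g b = 0 := by
      refine hD.1 (LinearMap.ext fun ψ => ?_)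
      have h1 : ψ (g b) = k ((ψ ∘ₗ g) ∘ₗ f) := hb' (ψ ∘ₗ g)
      rw [LinearMap.comp_assoc, h.comp_eq_zero, LinearMap.comp_zero, map_zero] at h1
      exact h1.trans (map_zero ψ).symm
    obtain ⟨a, rfl⟩ := (h.exact b).1 hgb
    refine ⟨a, ?_⟩
    ext φ
    obtain ⟨φ', rfl⟩ := he φ
    exact hb' φ'

theorem HasFiniteProjRes.fin (hM : HasFiniteProjRes R M) (n : ℕ) :
    HasFiniteProjRes R (Fin n → M) := by
  induction n with
  | zero => exact hasFiniteProjRes_of_projective inferInstance inferInstance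
  | succ n ih =>
    exact (isShortExact_inl_snd.hasFiniteProjRes_middle hM ih).of_equiv
      (Fin.consLinearEquiv R fun _ : Fin (n + 1) => M)

theorem IsLeftPerp.extVanish (h : IsLeftPerp R C M) : ExtVanish R M C :=
  (h (ModuleCat.of R R) (inferInstanceAs (Module.Projective R R))).of_retract_right
    (TensorProduct.rid R C).symm.toLinearMap (TensorProduct.rid R C).toLinearMap (by ext; simp)

/-- The dual `Hom(Rⁿ, C)` of a finite free module, written in the form `C ⊗ Q`. -/
noncomputable def homFinEquiv (R C : Type u) [CommRing R] [AddCommGroup C] [Module R C] (n : ℕ) :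
    ((Fin n → R) →ₗ[R] C) ≃ₗ[R] C ⊗[R] (Fin n → R) :=
  (Module.piEquiv (Fin n) R C).symm.trans (TensorProduct.piScalarRight R R C (Fin n)).symm

/-- The ring is `G_C`-projective: apply `Hom(-, C)` to a resolution of `C` by finite free modules;
the cosyzygies are the duals `Hom(X, C)` of the syzygies `X` of `C`. -/
theorem IsSemidualizing.isGCProjective_ring (hC : IsSemidualizing R C) :
    IsGCProjective R C R := by
  have key : IsGCProjective R C (C →ₗ[R] C) := by
    refine isGCProjective_of_closed (fun N => ∃ X : ModuleCat.{u} R, HasFiniteProjRes R X ∧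
      ExtVanish R X C ∧ IsBidual R C X ∧ HasFiniteProjRes R (X →ₗ[R] C) ∧
        ExtVanish R (X →ₗ[R] C) C ∧ N = ModuleCat.of R (X →ₗ[R] C)) ?_
      (ModuleCat.of R (C →ₗ[R] C)) ⟨ModuleCat.of R C, hC.finiteProjRes, hC.ext_eq_zero,
        hC.isBidual_self, ?_, ?_, rfl⟩
    · rintro _ ⟨X, hX, hXC, hbi, hN, hNC, rfl⟩
      obtain ⟨n, K, i, p, h, hK⟩ := hX.exists_fin_cover
      have he : Extends i C := h.extends_of_ext_one (hXC 1 le_rfl)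
      have hd := h.dual he
      have hF : HasFiniteProjRes R ((Fin n → R) →ₗ[R] C) :=
        (hC.finiteProjRes.fin n).of_equiv (Module.piEquiv (Fin n) R C)
      have hFC : ExtVanish R ((Fin n → R) →ₗ[R] C) C :=
        (hC.isLeftPerp_tensor (ModuleCat.of R (Fin n → R))
          (inferInstanceAs (Module.Projective R (Fin n → R)))).extVanish.of_equiv_left
          (homFinEquiv R C n)
      -- A functional on `Hom(X, C)` is evaluation at some `x`; lift `x` along `p`.
      have hde : Extends (LinearMap.lcomp R C p) C := by
        intro k
        obtain ⟨x, rfl⟩ := hbi.2 k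
        obtain ⟨y, rfl⟩ := h.surjective x
        exact ⟨LinearMap.applyₗ y, rfl⟩
      exact ⟨isLeftPerp_of_hasFiniteProjRes hN hNC, ModuleCat.of R (Fin n → R),
        ModuleCat.of R (K →ₗ[R] C), _, _, inferInstanceAs (Module.Projective R (Fin n → R)),
        hd.of_equiv_middle (homFinEquiv R C n), K, hK,
        h.extVanish_left (extVanish_of_projective inferInstance) hXC,
        h.isBidual_left he (hC.isBidual_fin n) hbi, hd.hasFiniteProjRes_right hN hF,
        hd.extVanish_right hNC hFC hde, rfl⟩
    · exact (hasFiniteProjRes_of_projective (P := R) inferInstance inferInstance).of_equiv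
        (LinearEquiv.ofBijective _ hC.homothety_bijective)
    · exact (extVanish_of_projective (M := R) inferInstance).of_equiv_left
        (LinearEquiv.ofBijective _ hC.homothety_bijective).symm
  exact key.of_equiv (LinearEquiv.ofBijective _ hC.homothety_bijective)

/-- A projective module is a retract of a free module, that is, of a direct sum of copies of `R`. -/
theorem IsSemidualizing.isGCProjective_of_projective (hC : IsSemidualizing R C)
    (hM : Module.Projective R M) : IsGCProjective R C M := by
  obtain ⟨s, hs⟩ := (Module.projective_def' (R := R) (P := M)).1 hM
  exact hC.isGCProjective_of_retract (hC.isGCProjective_finsupp hC.isGCProjective_ring M) s _ hs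

end

end GCProj

theorem theorem2p7 (R : Type u) [CommRing R] (C : Type u) [AddCommGroup C] [Module R C]
    (hC : GCProj.IsSemidualizing R C) :
    GCProj.IsProjectivelyResolving R (fun M => GCProj.IsGCProjective R C M) ∧
    GCProj.IsClosedUnderSummands R (fun M => GCProj.IsGCProjective R C M) ∧
    GCProj.IsClosedUnderSummands R
      (fun M => Module.Finite R M ∧ GCProj.IsGCProjective R C M) ∧
    GCProj.IsFiniteProjectivelyResolving R
      (fun M => GCProj.IsGCProjective R C M ∧ GCProj.HasFiniteProjRes R M) := by
  have summand : GCProj.IsClosedUnderSummands R (fun M => GCProj.IsGCProjective R C M) := by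
    rintro M A B ⟨e⟩ hM
    exact hC.isGCProjective_of_prod (hM.of_equiv e.symm)
  refine ⟨⟨fun P hP => hC.isGCProjective_of_projective hP, ?_⟩, summand, ?_,
    ⟨fun M hM => hM.2.finite, fun P hP hP' => ⟨hC.isGCProjective_of_projective hP',
      GCProj.hasFiniteProjRes_of_projective hP' hP⟩, ?_⟩⟩
  · intro M' M M'' f g hf hfg hg hM''
    have h : GCProj.IsShortExact f g := ⟨hf, hfg, hg⟩
    exact ⟨fun hM => hC.isGCProjective_left h hM hM'',
      fun hM' => hC.isGCProjective_middle h hM' hM''⟩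
  · rintro M A B ⟨e⟩ ⟨hM, hM'⟩
    exact ⟨Module.Finite.of_surjective (LinearMap.fst R A B ∘ₗ (e : M →ₗ[R] A × B))
      fun a => ⟨e.symm (a, 0), by simp⟩, summand M A B ⟨e⟩ hM'⟩
  · intro M' M M'' f g _ _ _ hf hfg hg hM''
    have h : GCProj.IsShortExact f g := ⟨hf, hfg, hg⟩
    exact ⟨fun hM => ⟨hC.isGCProjective_left h hM.1 hM''.1, h.hasFiniteProjRes_left hM.2 hM''.2⟩,
      fun hM' => ⟨hC.isGCProjective_middle h hM'.1 hM''.1,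
        h.hasFiniteProjRes_middle hM'.2 hM''.2⟩⟩
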